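/- **Theorem.** There exists a translation invariant site percolation $\hat X$ on $\mathbf{Z}^2$ such that, with probability $1$, both $$p_{c,bond}(G_{open}(\hat X))<1 \qquad\text{and}\qquad p_{c,bond}(G_{closed}(\hat X))<1 .$$ Here a *site percolation* on $\mathbf{Z}^2$ is a $\{0,1\}^{\mathbf{Z}^2}$-valued random object $X$; it is *translation invariant* if for all $n$ and all $x_1,\dots,x_n\in\mathbf{Z}^2$ the distribution of $(X(x_1+y),\dots,X(x_n+y))$ does not depend on $y\in\mathbf{Z}^2$. The random graph $G_{open}(X)$ (respectively $G_{closed}(X)$) has as its vertices all $x\in\mathbf{Z}^2$ with $X(x)=1$ (respectively $X(x)=0$), and as its edges all pairs of such vertices at $L_1$-distance $1$ from each other. For a countable, locally finite graph $G$, $p_{c,bond}(G)$ is the infimum over all $p\in[0,1]$ such that i.i.d. bond percolation on $G$ with retention parameter $p$ (each edge is kept with probability $p$, independently of the others, and all vertices are kept) produces a.s. at least one infinite connected component; $p_{c,bond}(G)=1$ if there is no such $p$. -/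

import Mathlib

open MeasureTheory ProbabilityTheory

noncomputable section

namespace SitePerc

/-- The square lattice: vertex set `ℤ × ℤ`, edges between the pairs at `L₁`-distance `1`. -/
def lattice : SimpleGraph (ℤ × ℤ) where
  Adj x y := |x.1 - y.1| + |x.2 - y.2| = 1
  symm := ⟨fun x y h => by rw [abs_sub_comm y.1, abs_sub_comm y.2]; exact h⟩
  loopless := ⟨fun x h => by simp at h⟩

/-- The graph on the open vertices (value `true`, that is, `1`) of a configuration `η`. -/
def openGraph (η : ℤ × ℤ → Bool) : SimpleGraph {x : ℤ × ℤ | η x = true} :=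
  lattice.induce {x : ℤ × ℤ | η x = true}

/-- The graph on the closed vertices (value `false`, that is, `0`) of a configuration `η`. -/
def closedGraph (η : ℤ × ℤ → Bool) : SimpleGraph {x : ℤ × ℤ | η x = false} :=
  lattice.induce {x : ℤ × ℤ | η x = false}

/-- The law of the random set of retained edges in i.i.d. bond percolation on `G` with
retention parameter `p`. -/
def bondPercolation {V : Type*} (G : SimpleGraph V) (p : unitInterval) :
    Measure (Set (Sym2 V)) :=
  setBernoulli G.edgeSet p

/-- The subgraph of `G` with the same vertices and with the edges of `G` that lie in `S`. -/
def retain {V : Type*} (G : SimpleGraph V) (S : Set (Sym2 V)) : SimpleGraph V :=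
  SimpleGraph.fromEdgeSet (G.edgeSet ∩ S)

/-- `G` has an infinite connected component. -/
def HasInfiniteCluster {V : Type*} (G : SimpleGraph V) : Prop :=
  ∃ C : G.ConnectedComponent, C.supp.Infinite

/-- The bond percolation critical value of `G`: the infimum of the `p ∈ [0, 1]` for which i.i.d.
bond percolation with retention parameter `p` has a.s. an infinite cluster. It is taken in the
complete lattice `[0, 1]`, so it is `1` if there is no such `p`. -/
def pcBond {V : Type*} (G : SimpleGraph V) : unitInterval :=
  sInf {p : unitInterval | ∀ᵐ S ∂(bondPercolation G p), HasInfiniteCluster (retain G S)}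

/-- Translation invariance of a random configuration `X`: for all `n` and `x₁, …, xₙ`, the
distribution of `(X (x₁ + y), …, X (xₙ + y))` does not depend on `y`. -/
def TranslationInvariant {Ω : Type*} [MeasurableSpace Ω] (P : Measure Ω)
    (X : Ω → ℤ × ℤ → Bool) : Prop :=
  ∀ (n : ℕ) (x : Fin n → ℤ × ℤ) (y z : ℤ × ℤ),
    P.map (fun ω i => X ω (x i + y)) = P.map (fun ω i => X ω (x i + z))

end SitePerc

end

open scoped ENNReal

/-! Both colours are made to contain an infinite chain of ever wider strips, built on one hierarchy
of nested square cells. In each cell of level `n + 1` the first row of subcells is open and the last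
row closed, across an axis alternating with `n`, and higher levels overrule lower ones. A
Haar-random hierarchy, indexed by pairs of 2-adic integers, makes this translation invariant. By
Borel–Cantelli the origin lies in an extreme row at finitely many levels only
(`ae_eventually_interior`). Beyond those, a strip of level `n` near the origin runs through almost a
whole cell of level `n + 2` and crosses the perpendicular strip of level `n + 1` of its colour
(`Nested.chain`).

Such a chain percolates at retention parameter near 1 by renormalisation. A cell is bad if it has
two bad subcells; this squares the probability of badness, up to the number of pairs, so it is at
most `2⁻¹ ^ (4 * n + 12)` (`measure_bad_le`). Cores of good cells are connected, also to those of
good neighbours (`core_linked`). A strip of level `n` has at most `2 ^ (2 * n + 5)` cells, so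
Borel–Cantelli makes all cells good from some level on, and their cores lie in one infinite cluster
(`Chain.pcBond_lt_one`). -/

namespace SitePerc

/-! ### Cells, bad cells and connected cores. -/

/-- The exponent of the side length of the cells of level `n`. -/
def expo : ℕ → ℕ
  | 0 => 0
  | n + 1 => expo n + (n + 2)

/-- The side length of the cells of level `n`. -/
def side (n : ℕ) : ℤ := 2 ^ expo n

lemma side_pos (n : ℕ) : 0 < side n := by unfold side; positivity

lemma side_succ (n : ℕ) : side (n + 1) = side n * 2 ^ (n + 2) := by
  simp [side, expo, pow_add]

lemma four_mul_side_le (n : ℕ) : 4 * side n ≤ side (n + 1) := by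
  rw [side_succ, pow_add]
  have h : (1 : ℤ) ≤ 2 ^ n := one_le_pow₀ (by norm_num)
  nlinarith [side_pos n]

/-- The unit vector in the direction of the first (`false`) or second (`true`) coordinate. -/
def unitVec (d : Bool) : ℤ × ℤ := if d then (0, 1) else (1, 0)

/-- The square of side length `side n` with lower left corner `c`. -/
def cell (n : ℕ) (c : ℤ × ℤ) : Set (ℤ × ℤ) :=
  {x | c.1 ≤ x.1 ∧ x.1 < c.1 + side n ∧ c.2 ≤ x.2 ∧ x.2 < c.2 + side n}

/-- The positions of the subcells of level `n` in a cell of level `n + 1`. -/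
noncomputable def positions (n : ℕ) : Finset (ℤ × ℤ) :=
  Finset.Ico 0 (2 ^ (n + 2)) ×ˢ Finset.Ico 0 (2 ^ (n + 2))

lemma mem_positions {n : ℕ} {i : ℤ × ℤ} :
    i ∈ positions n ↔ (0 ≤ i.1 ∧ i.1 < 2 ^ (n + 2)) ∧ 0 ≤ i.2 ∧ i.2 < 2 ^ (n + 2) := by
  simp [positions]

/-- A cell of level `0` is bad if it lies in `D`; a cell of level `n + 1` is bad if it has two bad
subcells of level `n`. -/
def Bad (D : Set (ℤ × ℤ)) : ℕ → ℤ × ℤ → Prop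
  | 0, c => c ∈ D
  | n + 1, c => ∃ i ∈ positions n, ∃ j ∈ positions n, i ≠ j ∧
      Bad D n (c + side n • i) ∧ Bad D n (c + side n • j)

/-- The core of a cell: the union of the cores of its good subcells. -/
def core (D : Set (ℤ × ℤ)) : ℕ → ℤ × ℤ → Set (ℤ × ℤ)
  | 0, c => {c}
  | n + 1, c => {x | ∃ i ∈ positions n, ¬ Bad D n (c + side n • i) ∧
      x ∈ core D n (c + side n • i)}

lemma bad_of_ne {D : Set (ℤ × ℤ)} {n : ℕ} {c i j : ℤ × ℤ} (hi : i ∈ positions n)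
    (hj : j ∈ positions n) (hij : i ≠ j) (bi : Bad D n (c + side n • i))
    (bj : Bad D n (c + side n • j)) : Bad D (n + 1) c :=
  ⟨i, hi, j, hj, hij, bi, bj⟩

lemma self_mem_cell (n : ℕ) (c : ℤ × ℤ) : c ∈ cell n c := by
  have := side_pos n
  simp only [cell, Set.mem_ofPred_eq]
  omega

lemma subcell_subset {n : ℕ} {i : ℤ × ℤ} (hi : i ∈ positions n) (c : ℤ × ℤ) :
    cell n (c + side n • i) ⊆ cell (n + 1) c := by
  rw [mem_positions] at hi
  obtain ⟨⟨h1, h2⟩, h3, h4⟩ := hi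
  have hs := side_pos n
  rintro x ⟨h5, h6, h7, h8⟩
  simp only [Prod.fst_add, Prod.snd_add, Prod.smul_fst, Prod.smul_snd, smul_eq_mul]
    at h5 h6 h7 h8
  refine ⟨?_, ?_, ?_, ?_⟩
  · nlinarith
  · rw [side_succ]; nlinarith
  · nlinarith
  · rw [side_succ]; nlinarith

lemma core_subset_cell (D : Set (ℤ × ℤ)) (n : ℕ) (c : ℤ × ℤ) : core D n c ⊆ cell n c := by
  induction n generalizing c with
  | zero => rintro x rfl; exact self_mem_cell 0 _
  | succ n ih =>
    rintro x ⟨i, hi, -, hx⟩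
    exact subcell_subset hi c (ih _ hx)

/-- Of two given subcells of a good cell at least one is good. Points of cores serve below to glue
links together. -/
lemma core_nonempty {D : Set (ℤ × ℤ)} {n : ℕ} {c : ℤ × ℤ} (h : ¬ Bad D n c) :
    (core D n c).Nonempty := by
  induction n generalizing c with
  | zero => exact ⟨c, rfl⟩
  | succ n ih =>
    have h0 : ((0, 0) : ℤ × ℤ) ∈ positions n := by rw [mem_positions]; simp
    have h1 : ((1, 0) : ℤ × ℤ) ∈ positions n := by
      rw [mem_positions]; simp; exact one_lt_pow₀ (by norm_num) (by omega)
    by_cases hb : Bad D n (c + side n • (0, 0))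
    · have : ¬ Bad D n (c + side n • (1, 0)) := fun hb' => h ⟨_, h0, _, h1, by simp, hb, hb'⟩
      obtain ⟨x, hx⟩ := ih this
      exact ⟨x, _, h1, this, hx⟩
    · obtain ⟨x, hx⟩ := ih hb
      exact ⟨x, _, h0, hb, hx⟩

/-- A square grid from which at most one vertex is removed is connected. -/
lemma grid_linked {M : ℤ} (hM : 2 ≤ M) (good : ℤ × ℤ → Prop) (Q : ℤ × ℤ → ℤ × ℤ → Prop)
    (hsymm : ∀ i j, Q i j → Q j i) (htrans : ∀ i j k, Q i j → Q j k → Q i k)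
    (b : ℤ × ℤ)
    (hb : ∀ i : ℤ × ℤ, (0 ≤ i.1 ∧ i.1 < M) ∧ (0 ≤ i.2 ∧ i.2 < M) → (good i ↔ i ≠ b))
    (hrefl : ∀ i : ℤ × ℤ, (0 ≤ i.1 ∧ i.1 < M) ∧ (0 ≤ i.2 ∧ i.2 < M) → good i → Q i i)
    (hstep : ∀ (i : ℤ × ℤ) (d : Bool), (0 ≤ i.1 ∧ i.1 < M) ∧ (0 ≤ i.2 ∧ i.2 < M) →
      (0 ≤ (i + unitVec d).1 ∧ (i + unitVec d).1 < M) ∧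
        (0 ≤ (i + unitVec d).2 ∧ (i + unitVec d).2 < M) →
      good i → good (i + unitVec d) → Q i (i + unitVec d))
    {i j : ℤ × ℤ} (hi : (0 ≤ i.1 ∧ i.1 < M) ∧ (0 ≤ i.2 ∧ i.2 < M))
    (hj : (0 ≤ j.1 ∧ j.1 < M) ∧ (0 ≤ j.2 ∧ j.2 < M)) (gi : good i) (gj : good j) : Q i j := by
  have row0 : ∀ r : ℤ, 0 ≤ r → r < M → r ≠ b.1 → ∀ k : ℕ, (k : ℤ) < M → Q (r, 0) (r, k) := by
    intro r hr hr' hrb k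
    have hg : ∀ t : ℤ, 0 ≤ t → t < M → good (r, t) := fun t h1 h2 =>
      (hb _ ⟨⟨hr, hr'⟩, h1, h2⟩).2 fun h => hrb (by rw [← h])
    induction k with
    | zero => intro _; exact hrefl _ ⟨⟨hr, hr'⟩, le_rfl, by simp; omega⟩ (hg _ le_rfl (by omega))
    | succ k ih =>
      intro hk
      push_cast at hk ⊢
      refine htrans _ _ _ (ih (by omega)) ?_
      have := hstep (r, k) true ⟨⟨hr, hr'⟩, by simp, by simp; omega⟩
        (by simp [unitVec]; omega) (hg _ (by omega) (by omega))
        (by simpa [unitVec] using hg (k + 1) (by omega) (by omega))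
      simpa [unitVec] using this
  have col0 : ∀ r : ℤ, 0 ≤ r → r < M → r ≠ b.2 → ∀ k : ℕ, (k : ℤ) < M → Q (0, r) (k, r) := by
    intro r hr hr' hrb k
    have hg : ∀ t : ℤ, 0 ≤ t → t < M → good (t, r) := fun t h1 h2 =>
      (hb _ ⟨⟨h1, h2⟩, hr, hr'⟩).2 fun h => hrb (by rw [← h])
    induction k with
    | zero => intro _; exact hrefl _ ⟨⟨le_rfl, by simp; omega⟩, hr, hr'⟩ (hg _ le_rfl (by omega))
    | succ k ih =>
      intro hk
      push_cast at hk ⊢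
      refine htrans _ _ _ (ih (by omega)) ?_
      have := hstep (k, r) false ⟨⟨by simp, by simp; omega⟩, hr, hr'⟩
        (by simp [unitVec]; omega) (hg _ (by omega) (by omega))
        (by simpa [unitVec] using hg (k + 1) (by omega) (by omega))
      simpa [unitVec] using this
  have row : ∀ r : ℤ, 0 ≤ r → r < M → r ≠ b.1 → ∀ s t : ℤ, 0 ≤ s → s < M → 0 ≤ t → t < M →
      Q (r, s) (r, t) := by
    intro r hr hr' hrb s t hs hs' ht ht'
    lift s to ℕ using hs
    lift t to ℕ using ht
    exact htrans _ _ _ (hsymm _ _ (row0 r hr hr' hrb s hs')) (row0 r hr hr' hrb t ht')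
  have col : ∀ r : ℤ, 0 ≤ r → r < M → r ≠ b.2 → ∀ s t : ℤ, 0 ≤ s → s < M → 0 ≤ t → t < M →
      Q (s, r) (t, r) := by
    intro r hr hr' hrb s t hs hs' ht ht'
    lift s to ℕ using hs
    lift t to ℕ using ht
    exact htrans _ _ _ (hsymm _ _ (col0 r hr hr' hrb s hs')) (col0 r hr hr' hrb t ht')
  obtain ⟨r, hr0, hr1, hrb⟩ : ∃ r : ℤ, 0 ≤ r ∧ r < M ∧ r ≠ b.1 := by
    by_cases h : b.1 = 0
    · exact ⟨1, by omega, by omega, by omega⟩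
    · exact ⟨0, by omega, by omega, by omega⟩
  obtain ⟨k, hk0, hk1, hkb⟩ : ∃ r : ℤ, 0 ≤ r ∧ r < M ∧ r ≠ b.2 := by
    by_cases h : b.2 = 0
    · exact ⟨1, by omega, by omega, by omega⟩
    · exact ⟨0, by omega, by omega, by omega⟩
  -- Both lines through `(r, k)` miss `b`. A good vertex has at least one line through it that
  -- misses `b`, and this line crosses one of those two.
  have anchor : ∀ i : ℤ × ℤ, (0 ≤ i.1 ∧ i.1 < M) ∧ (0 ≤ i.2 ∧ i.2 < M) → good i → Q i (r, k) := by
    rintro ⟨i1, i2⟩ ⟨⟨h1, h2⟩, h3, h4⟩ hg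
    have hne := (hb (i1, i2) ⟨⟨h1, h2⟩, h3, h4⟩).1 hg
    by_cases hi1 : i1 = b.1
    · have hi2 : i2 ≠ b.2 := fun h => hne (Prod.ext hi1 h)
      exact htrans _ _ _ (col i2 h3 h4 hi2 i1 r h1 h2 hr0 hr1)
        (row r hr0 hr1 hrb i2 k h3 h4 hk0 hk1)
    · exact htrans _ _ _ (row i1 h1 h2 hi1 i2 k h3 h4 hk0 hk1)
        (col k hk0 hk1 hkb i1 r h1 h2 hr0 hr1)
  exact htrans _ _ _ (anchor i hi gi) (hsymm _ _ (anchor j hj gj))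

/-- In a region `O` where neighbouring sites outside `D` are linked, the core of a good cell is
linked, and so are the cores of neighbouring good cells. -/
theorem core_linked {O D : Set (ℤ × ℤ)} {R : ℤ × ℤ → ℤ × ℤ → Prop}
    (hrefl : ∀ x ∈ O, R x x) (hsymm : ∀ x y, R x y → R y x)
    (htrans : ∀ x y z, R x y → R y z → R x z)
    (hstep : ∀ x d, x ∈ O → x + unitVec d ∈ O → x ∉ D → x + unitVec d ∉ D →
      R x (x + unitVec d)) (n : ℕ) :
    (∀ c, cell n c ⊆ O → ¬ Bad D n c → ∀ x ∈ core D n c, ∀ y ∈ core D n c, R x y) ∧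
    (∀ c d, cell n c ⊆ O → cell n (c + side n • unitVec d) ⊆ O → ¬ Bad D n c →
      ¬ Bad D n (c + side n • unitVec d) →
      ∀ x ∈ core D n c, ∀ y ∈ core D n (c + side n • unitVec d), R x y) := by
  induction n with
  | zero =>
    constructor
    · rintro c hc - x rfl y rfl
      exact hrefl _ (hc (self_mem_cell 0 _))
    · rintro c d hc hc' hb hb' x rfl y hy
      have h1 : side 0 = 1 := rfl
      rw [h1, one_smul] at hc' hb' hy
      obtain rfl : y = _ := hy
      exact hstep x d (hc (self_mem_cell 0 _)) (hc' (self_mem_cell 0 _)) hb hb'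
  | succ n ih =>
    have hM : (4 : ℤ) ≤ 2 ^ (n + 2) := by
      have h : (1 : ℤ) ≤ 2 ^ n := one_le_pow₀ (by norm_num)
      rw [pow_add]; omega
    obtain ⟨ihA, ihB⟩ := ih
    have A : ∀ c, cell (n + 1) c ⊆ O → ¬ Bad D (n + 1) c →
        ∀ x ∈ core D (n + 1) c, ∀ y ∈ core D (n + 1) c, R x y := by
      rintro c hc hbad x ⟨i, hi, hgi, hx⟩ y ⟨j, hj, hgj, hy⟩
      have hsub : ∀ i ∈ positions n, cell n (c + side n • i) ⊆ O := fun i hi =>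
        (subcell_subset hi c).trans hc
      obtain ⟨b, hb⟩ : ∃ b : ℤ × ℤ, ∀ i : ℤ × ℤ, i ∈ positions n →
          (¬ Bad D n (c + side n • i) ↔ i ≠ b) := by
        by_cases h : ∃ b ∈ positions n, Bad D n (c + side n • b)
        · obtain ⟨b, hb, hb'⟩ := h
          refine ⟨b, fun i hi => ⟨?_, fun hne hi' => hbad ⟨i, hi, b, hb, hne, hi', hb'⟩⟩⟩
          rintro h rfl
          exact h hb'
        · push Not at h
          -- Without a bad subcell, the removed vertex is put outside the grid.
          refine ⟨(-1, -1), fun i hi => ⟨fun _ => ?_, fun _ => h i hi⟩⟩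
          rintro rfl
          rw [mem_positions] at hi
          simp at hi
      -- The relation includes goodness: transitivity needs a point in the middle core.
      have key := grid_linked (M := 2 ^ (n + 2)) (by omega) (fun i => ¬ Bad D n (c + side n • i))
        (fun i j => ¬ Bad D n (c + side n • i) ∧ ¬ Bad D n (c + side n • j) ∧
          ∀ x ∈ core D n (c + side n • i), ∀ y ∈ core D n (c + side n • j), R x y)
        (fun i j h => ⟨h.2.1, h.1, fun x hx y hy => hsymm _ _ (h.2.2 y hy x hx)⟩) ?_ b
        (fun i hi => hb i (mem_positions.2 hi))
        (fun i hi hg => ⟨hg, hg, ihA _ (hsub i (mem_positions.2 hi)) hg⟩)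
        ?_ (mem_positions.1 hi) (mem_positions.1 hj) hgi hgj
      · exact key.2.2 x hx y hy
      · rintro i j k ⟨gi, gj, hij⟩ ⟨-, gk, hjk⟩
        refine ⟨gi, gk, fun x hx y hy => ?_⟩
        obtain ⟨z, hz⟩ := core_nonempty gj
        exact htrans _ _ _ (hij x hx z hz) (hjk z hz y hy)
      · intro i d hi hi' hg hg'
        refine ⟨hg, hg', ?_⟩
        have := ihB (c + side n • i) d (hsub i (mem_positions.2 hi))
          (by have := hsub _ (mem_positions.2 hi'); rwa [smul_add, ← add_assoc] at this)
          hg (by rwa [smul_add, ← add_assoc] at hg')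
        rwa [smul_add, ← add_assoc]
    refine ⟨A, fun c d hc hc' hb hb' x hx y hy => ?_⟩
    set c' := c + side (n + 1) • unitVec d with hc'def
    -- The subcells `p t` and `q t` face each other across the common side. Each cell has at most
    -- one bad subcell, so of three facing pairs at least one is entirely good.
    let p : ℤ → ℤ × ℤ := fun t => if d then (t, 2 ^ (n + 2) - 1) else (2 ^ (n + 2) - 1, t)
    let q : ℤ → ℤ × ℤ := fun t => if d then (t, 0) else (0, t)
    have hp : ∀ t, 0 ≤ t → t ≤ 2 → p t ∈ positions n := fun t h0 h2 => by
      rw [mem_positions]; cases d <;> simp [p] <;> omega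
    have hq : ∀ t, 0 ≤ t → t ≤ 2 → q t ∈ positions n := fun t h0 h2 => by
      rw [mem_positions]; cases d <;> simp [q] <;> omega
    have hpq : ∀ t, c' + side n • q t = c + side n • p t + side n • unitVec d := fun t => by
      rw [hc'def, side_succ]
      cases d <;> ext <;> simp [p, q, unitVec] <;> ring
    have hpi : ∀ s t, s ≠ t → p s ≠ p t := fun s t h h' => h (by cases d <;> simpa [p] using h')
    have hqi : ∀ s t, s ≠ t → q s ≠ q t := fun s t h h' => h (by cases d <;> simpa [q] using h')
    have hp2 : ∀ s t, 0 ≤ s → s ≤ 2 → 0 ≤ t → t ≤ 2 → s ≠ t →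
        Bad D n (c + side n • p s) → ¬ Bad D n (c + side n • p t) :=
      fun s t h1 h2 h3 h4 hne hs ht =>
        hb (bad_of_ne (hp s h1 h2) (hp t h3 h4) (hpi s t hne) hs ht)
    have hq2 : ∀ s t, 0 ≤ s → s ≤ 2 → 0 ≤ t → t ≤ 2 → s ≠ t →
        Bad D n (c' + side n • q s) → ¬ Bad D n (c' + side n • q t) :=
      fun s t h1 h2 h3 h4 hne hs ht =>
        hb' (bad_of_ne (hq s h1 h2) (hq t h3 h4) (hqi s t hne) hs ht)
    obtain ⟨t, ht0, ht2, hpt, hqt⟩ : ∃ t, 0 ≤ t ∧ t ≤ 2 ∧ ¬ Bad D n (c + side n • p t) ∧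
        ¬ Bad D n (c' + side n • q t) := by
      have b1 := hp2 0 1 (by omega) (by omega) (by omega) (by omega) (by omega)
      have b2 := hp2 0 2 (by omega) (by omega) (by omega) (by omega) (by omega)
      have b3 := hp2 1 2 (by omega) (by omega) (by omega) (by omega) (by omega)
      have e1 := hq2 0 1 (by omega) (by omega) (by omega) (by omega) (by omega)
      have e2 := hq2 0 2 (by omega) (by omega) (by omega) (by omega) (by omega)
      have e3 := hq2 1 2 (by omega) (by omega) (by omega) (by omega) (by omega)
      by_cases g0 : Bad D n (c + side n • p 0) ∨ Bad D n (c' + side n • q 0)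
      · by_cases g1 : Bad D n (c + side n • p 1) ∨ Bad D n (c' + side n • q 1)
        · refine ⟨2, by omega, by omega, ?_⟩
          rcases g0 with g0 | g0 <;> rcases g1 with g1 | g1
          · exact absurd g1 (b1 g0)
          · exact ⟨b2 g0, e3 g1⟩
          · exact ⟨b3 g1, e2 g0⟩
          · exact absurd g1 (e1 g0)
        · exact ⟨1, by omega, by omega, not_or.1 g1⟩
      · exact ⟨0, by omega, by omega, not_or.1 g0⟩
    obtain ⟨z, hz⟩ := core_nonempty hpt
    obtain ⟨w, hw⟩ := core_nonempty hqt
    have h1 : R x z := A c hc hb x hx z ⟨p t, hp t ht0 ht2, hpt, hz⟩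
    have h2 : R w y := A c' hc' hb' w ⟨q t, hq t ht0 ht2, hqt, hw⟩ y hy
    have hcell := (subcell_subset (hq t ht0 ht2) c').trans hc'
    rw [hpq] at hqt hw hcell
    exact htrans _ _ _ h1 (htrans _ _ _ (ihB _ d ((subcell_subset (hp t ht0 ht2) c).trans hc)
      hcell hpt hqt z hz w hw) h2)


/-! ### The probability that a cell is bad. -/

/-- The sites `x` such that one of the edges from `x` to `x + unitVec d` lies in `B`. Here the
edge from `x` to `x + unitVec d` is written as the pair `(x, d)`. -/
def badSites (B : Set ((ℤ × ℤ) × Bool)) : Set (ℤ × ℤ) := {x | ∃ d, (x, d) ∈ B}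

/-- A bound for the number of minimal reasons for a cell of level `n` to be bad. -/
def famCard : ℕ → ℕ
  | 0 => 2
  | n + 1 => (2 ^ (n + 2)) ^ 4 * famCard n ^ 2

/-- The exponent `4 * n + 12` turns the recursion into exact squaring, as `(4 * n + 8) + (4 * (n +
1) + 12) = 2 * (4 * n + 12)`. Level `0` then dictates the 13. -/
lemma famCard_mul_le (n : ℕ) : famCard n * 2 ^ (4 * n + 12) ≤ 2 ^ (13 * 2 ^ n) := by
  induction n with
  | zero => simp [famCard]
  | succ n ih =>
    calc famCard (n + 1) * 2 ^ (4 * (n + 1) + 12)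
        = (famCard n * 2 ^ (4 * n + 12)) ^ 2 := by
          simp only [famCard]; ring
      _ ≤ (2 ^ (13 * 2 ^ n)) ^ 2 := Nat.pow_le_pow_left ih 2
      _ = 2 ^ (13 * 2 ^ (n + 1)) := by rw [← pow_mul]; ring

lemma card_positions (n : ℕ) : (positions n).card = 2 ^ (n + 2) * 2 ^ (n + 2) := by
  have h : ((2 : ℤ) ^ (n + 2)).toNat = 2 ^ (n + 2) := by
    rw [Int.toNat_pow_of_nonneg (by norm_num)]; rfl
  simp [positions, h]

lemma disjoint_subcells {n : ℕ} {i j : ℤ × ℤ} (hij : i ≠ j) (c : ℤ × ℤ) :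
    Disjoint (cell n (c + side n • i)) (cell n (c + side n • j)) := by
  rw [Set.disjoint_left]
  rintro x ⟨h1, h2, h3, h4⟩ ⟨h5, h6, h7, h8⟩
  simp only [Prod.fst_add, Prod.snd_add, Prod.smul_fst, Prod.smul_snd, smul_eq_mul] at *
  have hs := side_pos n
  refine hij (Prod.ext ?_ ?_)
  · by_contra hne
    rcases lt_or_gt_of_ne hne with h | h <;> nlinarith
  · by_contra hne
    rcases lt_or_gt_of_ne hne with h | h <;> nlinarith

/-- If a cell of level `n` is bad, then one of at most `famCard n` given sets of `2 ^ n` edges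
consists of bad edges. -/
lemma exists_family (n : ℕ) (c : ℤ × ℤ) : ∃ 𝓕 : Finset (Finset ((ℤ × ℤ) × Bool)),
    𝓕.card ≤ famCard n ∧ (∀ F ∈ 𝓕, F.card = 2 ^ n ∧ ∀ e ∈ F, e.1 ∈ cell n c) ∧
    ∀ B : Set ((ℤ × ℤ) × Bool), Bad (badSites B) n c → ∃ F ∈ 𝓕, (F : Set ((ℤ × ℤ) × Bool)) ⊆ B := by
  classical
  induction n generalizing c with
  | zero =>
    refine ⟨{{(c, false)}, {(c, true)}}, Finset.card_le_two, ?_, ?_⟩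
    · intro F hF
      simp only [Finset.mem_insert, Finset.mem_singleton] at hF
      rcases hF with rfl | rfl <;> simp [self_mem_cell]
    · rintro B ⟨d, hd⟩
      cases d
      · exact ⟨{(c, false)}, by simp, by simpa using hd⟩
      · exact ⟨{(c, true)}, by simp, by simpa using hd⟩
  | succ n ih =>
    choose 𝓕 hcard hF hB using ih
    let T := ((positions n ×ˢ positions n).filter fun ij => ij.1 ≠ ij.2)
    refine ⟨T.biUnion fun ij => Finset.image₂ (· ∪ ·) (𝓕 (c + side n • ij.1))
      (𝓕 (c + side n • ij.2)), ?_, ?_, ?_⟩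
    · calc _ ≤ T.card * famCard n ^ 2 := by
            refine Finset.card_biUnion_le_card_mul _ _ _ fun ij _ => ?_
            refine Finset.card_image₂_le _ _ _ |>.trans ?_
            rw [sq]
            exact Nat.mul_le_mul (hcard _) (hcard _)
        _ ≤ famCard (n + 1) := by
            refine Nat.mul_le_mul_right _ ((Finset.card_filter_le _ _).trans ?_)
            rw [Finset.card_product, card_positions]
            exact le_of_eq (by ring)
    · intro F hFm
      simp only [Finset.mem_biUnion, Finset.mem_image₂] at hFm
      obtain ⟨⟨i, j⟩, hij, F₁, h₁, F₂, h₂, rfl⟩ := hFm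
      simp only [T, Finset.mem_filter, Finset.mem_product] at hij
      obtain ⟨⟨hi, hj⟩, hne⟩ := hij
      -- Edges are assigned to cells by their endpoint `e.1`, so disjoint subcells have disjoint
      -- edge sets and the cardinality doubles.
      have hd : Disjoint F₁ F₂ := by
        rw [Finset.disjoint_left]
        intro e he₁ he₂
        exact Set.disjoint_left.1 (disjoint_subcells hne c) ((hF _ _ h₁).2 e he₁)
          ((hF _ _ h₂).2 e he₂)
      refine ⟨?_, fun e he => ?_⟩
      · rw [Finset.card_union_of_disjoint hd, (hF _ _ h₁).1, (hF _ _ h₂).1]; ring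
      · rcases Finset.mem_union.1 he with he | he
        · exact subcell_subset hi c ((hF _ _ h₁).2 e he)
        · exact subcell_subset hj c ((hF _ _ h₂).2 e he)
    · rintro B ⟨i, hi, j, hj, hne, bi, bj⟩
      obtain ⟨F₁, h₁, s₁⟩ := hB _ B bi
      obtain ⟨F₂, h₂, s₂⟩ := hB _ B bj
      refine ⟨F₁ ∪ F₂, ?_, by simpa using ⟨s₁, s₂⟩⟩
      simp only [Finset.mem_biUnion, Finset.mem_image₂]
      exact ⟨(i, j), by simp [T, hne, hi, hj],
        F₁, h₁, F₂, h₂, rfl⟩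

/-- If edges are jointly bad with small probability, then cells of level `n` are bad with
probability at most `2 ^ (-4 n - 12)`. -/
lemma measure_bad_le {α : Type*} [MeasurableSpace α] (μ : Measure α)
    (B : α → Set ((ℤ × ℤ) × Bool))
    (hμ : ∀ F : Finset ((ℤ × ℤ) × Bool),
      μ {a | (F : Set ((ℤ × ℤ) × Bool)) ⊆ B a} ≤ ((2 : ℝ≥0∞)⁻¹ ^ 13) ^ F.card)
    (n : ℕ) (c : ℤ × ℤ) :
    μ {a | Bad (badSites (B a)) n c} ≤ (2 : ℝ≥0∞)⁻¹ ^ (4 * n + 12) := by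
  obtain ⟨𝓕, hcard, hF, hB⟩ := exists_family n c
  calc μ {a | Bad (badSites (B a)) n c}
      ≤ μ (⋃ F ∈ 𝓕, {a | (F : Set ((ℤ × ℤ) × Bool)) ⊆ B a}) := by
        refine measure_mono fun a ha => ?_
        obtain ⟨F, hF, h⟩ := hB _ ha
        exact Set.mem_biUnion hF h
    _ ≤ ∑ F ∈ 𝓕, μ {a | (F : Set ((ℤ × ℤ) × Bool)) ⊆ B a} := measure_biUnion_finset_le _ _
    _ ≤ ∑ F ∈ 𝓕, ((2 : ℝ≥0∞)⁻¹ ^ 13) ^ (2 ^ n) :=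
        Finset.sum_le_sum fun F h => (hμ F).trans (by rw [(hF F h).1])
    _ ≤ famCard n * ((2 : ℝ≥0∞)⁻¹ ^ 13) ^ (2 ^ n) := by
        rw [Finset.sum_const, nsmul_eq_mul]
        gcongr
    _ ≤ (2 : ℝ≥0∞)⁻¹ ^ (4 * n + 12) := by
        rw [← pow_mul, ← ENNReal.inv_pow, ← ENNReal.inv_pow, ← div_eq_mul_inv]
        refine ENNReal.div_le_of_le_mul ?_
        rw [mul_comm, ← div_eq_mul_inv, ENNReal.le_div_iff_mul_le (by simp) (by simp)]
        exact_mod_cast famCard_mul_le n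


/-! ### Closed edges in i.i.d. bond percolation. -/

lemma setBernoulli_disjoint_le {ι : Type*} (u : Set ι) (p : unitInterval) (F : Finset ι)
    (hF : (F : Set ι) ⊆ u) :
    setBernoulli u p {S | ∀ e ∈ F, e ∉ S} ≤
      ((unitInterval.toNNReal (unitInterval.symm p) : NNReal) : ℝ≥0∞) ^ F.card := by
  rw [setBernoulli_apply']
  have : ((fun p : ι → Prop ↦ {i | p i}) ⁻¹' {S | ∀ e ∈ F, e ∉ S}) =
      Set.pi (F : Set ι) (fun _ => {False}) := by
    ext q
    simp [Set.mem_pi]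
  rw [this, Measure.infinitePi_pi _ (fun i _ => MeasurableSet.of_discrete), ← Finset.prod_const]
  refine Finset.prod_le_prod' fun i hi => ?_
  have hiu : i ∈ u := hF hi
  simp [hiu]

/-- The edges `(x, d)` of the region `O` that are not in `S`. -/
def closedEdges (O : Set (ℤ × ℤ)) (S : Set (Sym2 O)) : Set ((ℤ × ℤ) × Bool) :=
  {e | ∃ (hx : e.1 ∈ O) (hy : e.1 + unitVec e.2 ∈ O),
    s((⟨e.1, hx⟩ : O), (⟨e.1 + unitVec e.2, hy⟩ : O)) ∉ S}

lemma lattice_adj_unitVec (x : ℤ × ℤ) (d : Bool) : lattice.Adj x (x + unitVec d) := by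
  cases d <;> simp [lattice, unitVec]

/-- An edge determines its left or lower endpoint and its direction, so distinct pairs code
distinct, hence independent, edges. -/
lemma edge_injective {x y : ℤ × ℤ} {d d' : Bool}
    (h : (x = y ∧ x + unitVec d = y + unitVec d') ∨ (x = y + unitVec d' ∧ x + unitVec d = y)) :
    (x, d) = (y, d') := by
  rcases h with ⟨rfl, h⟩ | ⟨rfl, h⟩
  · cases d <;> cases d' <;> simp_all [unitVec]
  · exfalso
    have h1 := congrArg Prod.fst h
    have h2 := congrArg Prod.snd h
    cases d <;> cases d' <;> simp [unitVec] at h1 h2 <;> omega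

lemma measure_closedEdges_le (O : Set (ℤ × ℤ)) (p : unitInterval)
    (F : Finset ((ℤ × ℤ) × Bool)) :
    bondPercolation (lattice.induce O) p {S | (F : Set ((ℤ × ℤ) × Bool)) ⊆ closedEdges O S} ≤
      ((unitInterval.toNNReal (unitInterval.symm p) : NNReal) : ℝ≥0∞) ^ F.card := by
  classical
  by_cases h : ∀ e ∈ F, e.1 ∈ O ∧ e.1 + unitVec e.2 ∈ O
  · let φ : F → Sym2 O := fun e =>
      s((⟨e.1.1, (h e.1 e.2).1⟩ : O), (⟨e.1.1 + unitVec e.1.2, (h e.1 e.2).2⟩ : O))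
    have hφ : Function.Injective φ := by
      rintro ⟨⟨x, d⟩, he⟩ ⟨⟨y, d'⟩, he'⟩ heq
      simp only [φ, Sym2.eq_iff, Subtype.mk.injEq] at heq
      exact Subtype.ext (edge_injective heq)
    have hcard : (F.attach.image φ).card = F.card := by
      rw [Finset.card_image_of_injective _ hφ, Finset.card_attach]
    rw [← hcard]
    refine (measure_mono ?_).trans (setBernoulli_disjoint_le _ p (F.attach.image φ) ?_)
    · intro S hS e he
      simp only [Finset.mem_image] at he
      obtain ⟨f, -, rfl⟩ := he
      obtain ⟨_, _, h3⟩ := hS f.2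
      exact h3
    · intro e he
      simp only [Finset.coe_image, Set.mem_image] at he
      obtain ⟨f, -, rfl⟩ := he
      exact lattice_adj_unitVec _ _
  · have : {S | (F : Set ((ℤ × ℤ) × Bool)) ⊆ closedEdges O S} = ∅ := by
      rw [Set.eq_empty_iff_forall_notMem]
      intro S hS
      refine h fun e he => ?_
      obtain ⟨h1, h2, -⟩ := hS he
      exact ⟨h1, h2⟩
    rw [this]
    simp

/-- The sites `x` and `y` are in the same component of a graph on `O`. -/
def Linked {O : Set (ℤ × ℤ)} (H : SimpleGraph O) (x y : ℤ × ℤ) : Prop :=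
  ∃ (hx : x ∈ O) (hy : y ∈ O), H.Reachable ⟨x, hx⟩ ⟨y, hy⟩

lemma Linked.symm {O : Set (ℤ × ℤ)} {H : SimpleGraph O} {x y : ℤ × ℤ} :
    Linked H x y → Linked H y x := fun ⟨hx, hy, h⟩ => ⟨hy, hx, h.symm⟩

lemma Linked.trans {O : Set (ℤ × ℤ)} {H : SimpleGraph O} {x y z : ℤ × ℤ} :
    Linked H x y → Linked H y z → Linked H x z :=
  fun ⟨hx, _, h⟩ ⟨_, hz, h'⟩ => ⟨hx, hz, h.trans h'⟩

lemma linked_retain {O : Set (ℤ × ℤ)} (S : Set (Sym2 O)) {x : ℤ × ℤ} {d : Bool} (hx : x ∈ O)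
    (hy : x + unitVec d ∈ O) (hD : x ∉ badSites (closedEdges O S)) :
    Linked (retain (lattice.induce O) S) x (x + unitVec d) := by
  refine ⟨hx, hy, SimpleGraph.Adj.reachable ?_⟩
  have hS : s((⟨x, hx⟩ : O), (⟨x + unitVec d, hy⟩ : O)) ∈ S := by
    by_contra hS
    exact hD ⟨d, hx, hy, hS⟩
  rw [retain, SimpleGraph.fromEdgeSet_adj]
  have hadj : (lattice.induce O).Adj ⟨x, hx⟩ ⟨x + unitVec d, hy⟩ := lattice_adj_unitVec x d
  exact ⟨⟨hadj, hS⟩, hadj.ne⟩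

/-! ### Percolation along a chain of rows. -/

/-- Rows of cells in the region `O`, row `n` consisting of cells of level `n`, such that
consecutive rows meet. -/
structure Chain (O : Set (ℤ × ℤ)) where
  /-- The lower left corners of the cells. -/
  corner : ℕ → ℕ → ℤ × ℤ
  /-- The direction of a row. -/
  dir : ℕ → Bool
  /-- The index of the last cell of a row. -/
  len : ℕ → ℕ
  /-- The first row that is considered. -/
  start : ℕ
  corner_succ : ∀ n t, corner n (t + 1) = corner n t + side n • unitVec (dir n)
  two_le_len : ∀ n, 2 ≤ len n
  len_lt : ∀ n, len n < 2 ^ (2 * n + 5)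
  cell_subset : ∀ n, start ≤ n → ∀ t ≤ len n, cell n (corner n t) ⊆ O
  meets : ∀ n, start ≤ n → ∃ t ≤ len n, ∃ t' ≤ len (n + 1), ∃ i ∈ positions n,
    corner n t = corner (n + 1) t' + side n • i

namespace Chain

variable {O : Set (ℤ × ℤ)} (K : Chain O)

lemma row_linked {D : Set (ℤ × ℤ)} {R : ℤ × ℤ → ℤ × ℤ → Prop}
    (hrefl : ∀ x ∈ O, R x x) (hsymm : ∀ x y, R x y → R y x)
    (htrans : ∀ x y z, R x y → R y z → R x z)
    (hstep : ∀ x d, x ∈ O → x + unitVec d ∈ O → x ∉ D → x + unitVec d ∉ D →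
      R x (x + unitVec d)) {n : ℕ} (hn : K.start ≤ n)
    (hgood : ∀ t ≤ K.len n, ¬ Bad D n (K.corner n t)) {s t : ℕ} (hs : s ≤ K.len n)
    (ht : t ≤ K.len n) {x y : ℤ × ℤ} (hx : x ∈ core D n (K.corner n s))
    (hy : y ∈ core D n (K.corner n t)) : R x y := by
  obtain ⟨A, B⟩ := core_linked hrefl hsymm htrans hstep n
  have key : ∀ t ≤ K.len n, ∀ x ∈ core D n (K.corner n 0), ∀ y ∈ core D n (K.corner n t),
      R x y := by
    intro t
    induction t with
    | zero => exact fun h => A _ (K.cell_subset n hn 0 h) (hgood 0 h)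
    | succ t ih =>
      intro h x hx y hy
      obtain ⟨z, hz⟩ := core_nonempty (hgood t (by omega))
      have h1 := K.cell_subset n hn _ h
      have h2 := hgood _ h
      rw [K.corner_succ] at hy h1 h2
      exact htrans _ _ _ (ih (by omega) x hx z hz) (B _ _ (K.cell_subset n hn t (by omega))
        h1 (hgood t (by omega)) h2 z hz y hy)
  obtain ⟨z, hz⟩ := core_nonempty (hgood 0 (by omega))
  exact htrans _ _ _ (hsymm _ _ (key s hs z hz x hx)) (key t ht z hz y hy)

/-- Where consecutive rows meet, a good cell of row `n` is a subcell of a cell of row `n + 1`, and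
its core is part of the larger core. -/
lemma linked_of_good {D : Set (ℤ × ℤ)} {R : ℤ × ℤ → ℤ × ℤ → Prop}
    (hrefl : ∀ x ∈ O, R x x) (hsymm : ∀ x y, R x y → R y x)
    (htrans : ∀ x y z, R x y → R y z → R x z)
    (hstep : ∀ x d, x ∈ O → x + unitVec d ∈ O → x ∉ D → x + unitVec d ∉ D →
      R x (x + unitVec d)) {m : ℕ} (hm : K.start ≤ m)
    (hgood : ∀ n, m ≤ n → ∀ t ≤ K.len n, ¬ Bad D n (K.corner n t))
    {x : ℤ × ℤ} (hx : x ∈ core D m (K.corner m 0)) {n : ℕ} (hn : m ≤ n) {t : ℕ}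
    (ht : t ≤ K.len n) {y : ℤ × ℤ} (hy : y ∈ core D n (K.corner n t)) : R x y := by
  induction n, hn using Nat.le_induction generalizing t y with
  | base =>
    exact K.row_linked hrefl hsymm htrans hstep hm (hgood m le_rfl) (Nat.zero_le _) ht hx hy
  | succ n hn ih =>
    obtain ⟨t₁, ht₁, t₂, ht₂, i, hi, heq⟩ := K.meets n (hm.trans hn)
    have hg := hgood n hn t₁ ht₁
    obtain ⟨z, hz⟩ := core_nonempty hg
    have hz' : z ∈ core D (n + 1) (K.corner (n + 1) t₂) := by
      rw [heq] at hg hz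
      exact ⟨i, hi, hg, hz⟩
    exact htrans _ _ _ (ih ht₁ hz) (K.row_linked hrefl hsymm htrans hstep (by omega)
      (hgood (n + 1) (by omega)) ht₂ ht hz' hy)

lemma le_side (n : ℕ) : (n : ℤ) ≤ side n := by
  induction n with
  | zero => simp [side]
  | succ n ih =>
    have := four_mul_side_le n
    have := side_pos n
    push_cast
    omega

/-- The cluster is unbounded: it contains points of cells `0` and `2` of every row `n ≥ m`, which
are separated by a cell of side at least `n`. -/
lemma hasInfiniteCluster_of_good (S : Set (Sym2 O)) {m : ℕ} (hm : K.start ≤ m)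
    (hgood : ∀ n, m ≤ n → ∀ t ≤ K.len n, ¬ Bad (badSites (closedEdges O S)) n (K.corner n t)) :
    HasInfiniteCluster (retain (lattice.induce O) S) := by
  set D := badSites (closedEdges O S)
  set H := retain (lattice.induce O) S
  have hlink : ∀ x ∈ core D m (K.corner m 0), ∀ n, m ≤ n → ∀ t ≤ K.len n,
      ∀ y ∈ core D n (K.corner n t), Linked H x y := fun x hx n hn t ht y hy =>
    K.linked_of_good (D := D) (R := Linked H) (fun x hx => ⟨hx, hx, SimpleGraph.Reachable.refl _⟩)
      (fun _ _ => Linked.symm) (fun _ _ _ => Linked.trans)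
      (fun x d hx hy hD _ => linked_retain S hx hy hD) hm hgood hx hn ht hy
  obtain ⟨x, hx⟩ := core_nonempty (hgood m le_rfl 0 (Nat.zero_le _))
  have hxO : x ∈ O := K.cell_subset m hm 0 (Nat.zero_le _) (core_subset_cell _ _ _ hx)
  refine ⟨H.connectedComponentMk ⟨x, hxO⟩, fun hfin => ?_⟩
  obtain ⟨N, hN⟩ : ∃ N : ℕ, ∀ y, Linked H x y → |y.1| ≤ N ∧ |y.2| ≤ N := by
    have hfin' := hfin.image (fun y : O => (y : ℤ × ℤ).1.natAbs + (y : ℤ × ℤ).2.natAbs)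
    obtain ⟨N, hN⟩ := hfin'.bddAbove
    refine ⟨N, fun y hy => ?_⟩
    obtain ⟨_, hyO, hr⟩ := hy
    have : y.1.natAbs + y.2.natAbs ≤ N :=
      hN ⟨⟨y, hyO⟩, SimpleGraph.ConnectedComponent.eq.2 hr.symm, rfl⟩
    simp only [Int.abs_eq_natAbs]
    omega
  set n := max m (2 * N + 1)
  have hn : m ≤ n := le_max_left _ _
  have hnN : 2 * N + 1 ≤ n := le_max_right _ _
  have hl := K.two_le_len n
  obtain ⟨y, hy⟩ := core_nonempty (hgood n hn 0 (by omega))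
  obtain ⟨z, hz⟩ := core_nonempty (hgood n hn 2 hl)
  have ly := hN y (hlink x hx n hn 0 (by omega) y hy)
  have lz := hN z (hlink x hx n hn 2 hl z hz)
  obtain ⟨y1, y2, y3, y4⟩ := core_subset_cell _ _ _ hy
  obtain ⟨z1, z2, z3, z4⟩ := core_subset_cell _ _ _ hz
  rw [K.corner_succ, K.corner_succ] at z1 z3
  have := le_side n
  simp only [abs_le] at ly lz
  cases hd : K.dir n <;> simp [hd, unitVec] at z1 z3 <;> omega

/-- With edges closed with probability `2⁻¹ ^ 13`, row `n` contains a bad cell with probability at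
most `2⁻¹ ^ (2 * n + 7)`, which is summable. -/
theorem pcBond_lt_one {O : Set (ℤ × ℤ)} (K : Chain O) : pcBond (lattice.induce O) < 1 := by
  let q : unitInterval := ⟨2⁻¹ ^ 13, by positivity, by norm_num⟩
  refine lt_of_le_of_lt (sInf_le (a := unitInterval.symm q) ?_) ?_
  swap
  · rw [← Subtype.coe_lt_coe]
    simp only [unitInterval.coe_symm_eq, q]
    norm_num
  set μ := bondPercolation (lattice.induce O) (unitInterval.symm q)
  have hq : ((unitInterval.toNNReal (unitInterval.symm (unitInterval.symm q)) : NNReal) : ℝ≥0∞)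
      = (2 : ℝ≥0∞)⁻¹ ^ 13 := by
    rw [unitInterval.symm_symm]
    have : unitInterval.toNNReal q = (2 : NNReal)⁻¹ ^ 13 := by
      ext; simp [q]
    rw [this]
    simp [ENNReal.inv_pow]
  have hbad : ∀ n c, μ {S | Bad (badSites (closedEdges O S)) n c} ≤
      (2 : ℝ≥0∞)⁻¹ ^ (4 * n + 12) := fun n c =>
    measure_bad_le μ (closedEdges O) (fun F => (measure_closedEdges_le O _ F).trans_eq
      (by rw [hq])) n c
  have hrow : ∀ n, μ {S | ∃ t ≤ K.len n, Bad (badSites (closedEdges O S)) n (K.corner n t)} ≤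
      (2 : ℝ≥0∞)⁻¹ ^ n := by
    intro n
    calc _ ≤ μ (⋃ t ∈ Finset.range (2 ^ (2 * n + 5)),
            {S | Bad (badSites (closedEdges O S)) n (K.corner n t)}) := by
          refine measure_mono ?_
          rintro S ⟨t, ht, h⟩
          exact Set.mem_biUnion (Finset.mem_range.2 (ht.trans_lt (K.len_lt n))) h
      _ ≤ ∑ t ∈ Finset.range (2 ^ (2 * n + 5)),
            μ {S | Bad (badSites (closedEdges O S)) n (K.corner n t)} :=
          measure_biUnion_finset_le _ _
      _ ≤ ∑ t ∈ Finset.range (2 ^ (2 * n + 5)), (2 : ℝ≥0∞)⁻¹ ^ (4 * n + 12) :=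
          Finset.sum_le_sum fun t _ => hbad n _
      _ = 2 ^ (2 * n + 5) * (2 : ℝ≥0∞)⁻¹ ^ (4 * n + 12) := by simp
      _ = (2 : ℝ≥0∞)⁻¹ ^ (2 * n + 7) := by
          rw [show 4 * n + 12 = (2 * n + 5) + (2 * n + 7) by ring,
            pow_add _ (2 * n + 5) (2 * n + 7), ← mul_assoc,
            ← mul_pow, ENNReal.mul_inv_cancel (by simp) (by simp), one_pow, one_mul]
      _ ≤ (2 : ℝ≥0∞)⁻¹ ^ n :=
          pow_le_pow_of_le_one zero_le (ENNReal.inv_le_one.2 (by norm_num)) (by omega)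
  have hsum : ∑' n, μ {S | ∃ t ≤ K.len n,
      Bad (badSites (closedEdges O S)) n (K.corner n t)} ≠ ∞ := by
    refine ne_top_of_le_ne_top ?_ (ENNReal.tsum_le_tsum hrow)
    rw [ENNReal.tsum_geometric, ENNReal.one_sub_inv_two, inv_inv]
    exact ENNReal.ofNat_ne_top
  filter_upwards [ae_eventually_notMem hsum] with S hS
  obtain ⟨m, hm⟩ := Filter.eventually_atTop.1 hS
  refine K.hasInfiniteCluster_of_good S (le_max_right m K.start) fun n hn t ht hb => ?_
  exact hm n (le_of_max_le_left hn) ⟨t, ht, hb⟩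

end Chain


/-! ### The hierarchical pattern and its strips. -/

/-- The first (`false`) or second (`true`) coordinate. -/
def proj (d : Bool) (x : ℤ × ℤ) : ℤ := if d then x.2 else x.1

/-- The point with coordinate `a` in direction `d` and `b` in the other direction. -/
def pt (d : Bool) (a b : ℤ) : ℤ × ℤ := if d then (b, a) else (a, b)

@[simp] lemma proj_pt (d : Bool) (a b : ℤ) : proj d (pt d a b) = a := by
  cases d <;> rfl

@[simp] lemma proj_not_pt (d : Bool) (a b : ℤ) : proj (!d) (pt d a b) = b := by
  cases d <;> rfl

lemma ext_proj {x y : ℤ × ℤ} (d : Bool) (h : proj d x = proj d y)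
    (h' : proj (!d) x = proj (!d) y) : x = y := by
  cases d
  · exact Prod.ext h h'
  · exact Prod.ext h' h

@[simp] lemma proj_add (d : Bool) (x y : ℤ × ℤ) : proj d (x + y) = proj d x + proj d y := by
  cases d <;> rfl

@[simp] lemma proj_smul (d : Bool) (k : ℤ) (x : ℤ × ℤ) : proj d (k • x) = k * proj d x := by
  cases d <;> rfl

@[simp] lemma proj_zero (d : Bool) : proj d 0 = 0 := by cases d <;> rfl

lemma pt_not (d : Bool) (a b : ℤ) : pt (!d) a b = pt d b a := by cases d <;> rfl

lemma unitVec_not (d : Bool) : unitVec (!d) = pt d 0 1 := by cases d <;> rfl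

lemma mem_cell_proj {n : ℕ} {c x : ℤ × ℤ} (hx : x ∈ cell n c) (d : Bool) :
    proj d c ≤ proj d x ∧ proj d x < proj d c + side n := by
  obtain ⟨h1, h2, h3, h4⟩ := hx
  cases d
  · exact ⟨h1, h2⟩
  · exact ⟨h3, h4⟩

lemma pt_mem_positions {n : ℕ} {d : Bool} {a b : ℤ} (ha : 0 ≤ a) (ha' : a < 2 ^ (n + 2))
    (hb : 0 ≤ b) (hb' : b < 2 ^ (n + 2)) : pt d a b ∈ positions n := by
  rw [mem_positions]
  cases d
  · exact ⟨⟨ha, ha'⟩, hb, hb'⟩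
  · exact ⟨⟨hb, hb'⟩, ha, ha'⟩

/-- The coordinate that is used at level `n`. -/
def axis (n : ℕ) : Bool := n.bodd

lemma axis_succ (n : ℕ) : axis (n + 1) = !axis n := Nat.bodd_succ n

/-- The coordinate of `x` used at level `n`, relative to the cell of level `n + 1` around `x`, in
the hierarchy of cells given by the origins `-u 0, -u 1, …`. -/
def offset (u : ℕ → ℤ × ℤ) (n : ℕ) (x : ℤ × ℤ) : ℤ :=
  (proj (axis n) x + proj (axis n) (u (n + 1))) % side (n + 1)

/-- `x` lies in the first row of cells of level `n` within its cell of level `n + 1`. -/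
def Low (u : ℕ → ℤ × ℤ) (n : ℕ) (x : ℤ × ℤ) : Prop := offset u n x < side n

/-- `x` lies in the last row of cells of level `n` within its cell of level `n + 1`. -/
def High (u : ℕ → ℤ × ℤ) (n : ℕ) (x : ℤ × ℤ) : Prop := side (n + 1) - side n ≤ offset u n x

/-- `x` is open if the last level at which it lies in a first or in a last row exists, and it lies
in a first row at this level. -/
def Pattern (u : ℕ → ℤ × ℤ) (x : ℤ × ℤ) : Prop := ∃ n, Low u n x ∧ ∀ m, n < m → ¬ High u m x

/-- The cells around `0` with lower left corners `-u 0, -u 1, …` are nested. -/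
structure Nested (u : ℕ → ℤ × ℤ) : Prop where
  nonneg : ∀ n d, 0 ≤ proj d (u n)
  lt : ∀ n d, proj d (u n) < side n
  dvd : ∀ n d, side n ∣ proj d (u (n + 1)) - proj d (u n)

lemma not_pattern {u : ℕ → ℤ × ℤ} {n : ℕ} {x : ℤ × ℤ} (h : High u n x)
    (h' : ∀ m, n < m → ¬ Low u m x) : ¬ Pattern u x := by
  rintro ⟨m, hm, hm'⟩
  rcases lt_trichotomy m n with hlt | rfl | hlt
  · exact hm' n hlt h
  · have := four_mul_side_le m
    have := side_pos m
    unfold Low at hm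
    unfold High at h
    omega
  · exact h' m hlt hm

/-- The index of the last cell in a row of cells of level `n`. -/
def rowLen (n : ℕ) : ℕ := 2 ^ (n + 2) * (2 ^ (n + 3) - 1) - 1

lemma two_le_rowLen (n : ℕ) : 2 ≤ rowLen n := by
  have h1 : 4 ≤ 2 ^ (n + 2) := by
    rw [pow_add]; have := Nat.one_le_two_pow (n := n); omega
  have h2 : 8 ≤ 2 ^ (n + 3) := by
    rw [pow_add]; have := Nat.one_le_two_pow (n := n); omega
  have : 4 * 7 ≤ 2 ^ (n + 2) * (2 ^ (n + 3) - 1) := Nat.mul_le_mul h1 (by omega)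
  unfold rowLen
  omega

lemma rowLen_lt (n : ℕ) : rowLen n < 2 ^ (2 * n + 5) := by
  have h1 : 2 ^ (n + 2) * (2 ^ (n + 3) - 1) < 2 ^ (n + 2) * 2 ^ (n + 3) :=
    Nat.mul_lt_mul_of_pos_left (Nat.sub_lt (by positivity) one_pos) (by positivity)
  rw [← pow_add, show n + 2 + (n + 3) = 2 * n + 5 by ring] at h1
  unfold rowLen
  omega

/-- A row spans a cell of level `n + 2` except for one cell of level `n + 1` at an end, where level
`n + 1` imposes the other colour. -/
lemma le_rowLen_iff {n t : ℕ} :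
    t ≤ rowLen n ↔ side n * t + side n ≤ side (n + 2) - side (n + 1) := by
  have h1 : (rowLen n : ℤ) + 1 = 2 ^ (n + 2) * (2 ^ (n + 3) - 1) := by
    have h2 : rowLen n + 1 = 2 ^ (n + 2) * (2 ^ (n + 3) - 1) := by
      have := two_le_rowLen n
      unfold rowLen at *
      omega
    have h3 := congrArg (Nat.cast : ℕ → ℤ) h2
    rw [Nat.cast_mul, Nat.cast_sub Nat.one_le_two_pow] at h3
    exact_mod_cast h3
  have h2 : side (n + 2) - side (n + 1) = side n * (rowLen n + 1) := by
    rw [h1, side_succ (n + 1), side_succ n]; ring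
  rw [h2, ← mul_add_one, mul_le_mul_iff_right₀ (side_pos n)]
  omega

namespace Nested

variable {u : ℕ → ℤ × ℤ} (hu : Nested u)

include hu

lemma exists_eq (n : ℕ) (d : Bool) :
    ∃ k : ℕ, (k : ℤ) < 2 ^ (n + 2) ∧ proj d (u (n + 1)) = proj d (u n) + side n * k := by
  obtain ⟨k, hk⟩ := hu.dvd n d
  have h1 := hu.nonneg n d
  have h2 := hu.lt n d
  have h3 := hu.nonneg (n + 1) d
  have h4 := hu.lt (n + 1) d
  have hs := side_pos n
  rw [side_succ] at h4
  have hk0 : 0 ≤ k := by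
    by_contra h
    have : k ≤ -1 := by omega
    nlinarith
  lift k to ℕ using hk0
  refine ⟨k, ?_, by omega⟩
  by_contra h
  have : (2 : ℤ) ^ (n + 2) ≤ k := by omega
  nlinarith

lemma inside_succ {n : ℕ} {d : Bool} {a : ℤ} (h0 : 0 ≤ a + proj d (u n))
    (h1 : a + proj d (u n) < side n) :
    0 ≤ a + proj d (u (n + 1)) ∧ a + proj d (u (n + 1)) < side (n + 1) := by
  obtain ⟨k, hk, heq⟩ := hu.exists_eq n d
  have hs := side_pos n
  rw [heq, side_succ]
  constructor
  · have : 0 ≤ side n * k := by positivity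
    omega
  · nlinarith

lemma offset_zero (n : ℕ) : offset u n 0 = proj (axis n) (u (n + 1)) := by
  rw [offset, proj_zero, zero_add, Int.emod_eq_of_lt (hu.nonneg _ _) (hu.lt _ _)]

/-- Being in an extreme row of level `n` depends only on the index `k` of the level `n` cell along
the axis, which all points of that cell share with the origin. -/
lemma not_low_not_high {n : ℕ} (hlow : ¬ Low u n 0) (hhigh : ¬ High u n 0) {x : ℤ × ℤ}
    (h0 : 0 ≤ proj (axis n) x + proj (axis n) (u n))
    (h1 : proj (axis n) x + proj (axis n) (u n) < side n) : ¬ Low u n x ∧ ¬ High u n x := by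
  obtain ⟨h2, h3⟩ := hu.inside_succ h0 h1
  have h4 := hu.lt n (axis n)
  have h5 := hu.nonneg n (axis n)
  have hs := side_pos n
  rw [Low, hu.offset_zero] at hlow
  rw [High, hu.offset_zero] at hhigh
  rw [Low, High, offset, Int.emod_eq_of_lt h2 h3]
  obtain ⟨k, hk, heq⟩ := hu.exists_eq n (axis n)
  rw [side_succ] at hhigh
  rw [side_succ]
  rw [heq] at hlow hhigh ⊢
  have hk1 : 1 ≤ (k : ℤ) := by
    by_contra h
    have : (k : ℤ) = 0 := by omega
    rw [this] at hlow
    omega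
  have hk2 : (k : ℤ) ≤ 2 ^ (n + 2) - 2 := by
    by_contra h
    have : (k : ℤ) = 2 ^ (n + 2) - 1 := by omega
    rw [this, mul_sub] at hhigh
    omega
  constructor <;> nlinarith

lemma not_low_not_high_of_le {n₀ : ℕ} (h : ∀ n, n₀ ≤ n → ¬ Low u n 0 ∧ ¬ High u n 0)
    {x : ℤ × ℤ} (h0 : ∀ d, 0 ≤ proj d x + proj d (u n₀))
    (h1 : ∀ d, proj d x + proj d (u n₀) < side n₀) {m : ℕ} (hm : n₀ ≤ m) :
    ¬ Low u m x ∧ ¬ High u m x := by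
  have key : ∀ d, 0 ≤ proj d x + proj d (u m) ∧ proj d x + proj d (u m) < side m := by
    intro d
    induction m, hm using Nat.le_induction with
    | base => exact ⟨h0 d, h1 d⟩
    | succ m _ ih => exact hu.inside_succ ih.1 ih.2
  exact hu.not_low_not_high (h m hm).1 (h m hm).2 (key _).1 (key _).2

/-- The colour of a point of a row of cells of level `n`. -/
lemma row_colour {n₀ n : ℕ} (hn : n₀ ≤ n) (h : ∀ n, n₀ ≤ n → ¬ Low u n 0 ∧ ¬ High u n 0)
    {x : ℤ × ℤ} (h0 : 0 ≤ proj (axis n) x + proj (axis n) (u (n + 1)))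
    (h1 : proj (axis n) x + proj (axis n) (u (n + 1)) < side (n + 1))
    (h2 : 0 ≤ proj (!axis n) x + proj (!axis n) (u (n + 2)))
    (h3 : proj (!axis n) x + proj (!axis n) (u (n + 2)) < side (n + 2)) :
    (proj (axis n) x + proj (axis n) (u (n + 1)) < side n →
      proj (!axis n) x + proj (!axis n) (u (n + 2)) < side (n + 2) - side (n + 1) →
      Pattern u x) ∧
    (side (n + 1) - side n ≤ proj (axis n) x + proj (axis n) (u (n + 1)) →
      side (n + 1) ≤ proj (!axis n) x + proj (!axis n) (u (n + 2)) → ¬ Pattern u x) := by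
  have e0 : offset u n x = proj (axis n) x + proj (axis n) (u (n + 1)) := by
    rw [offset, Int.emod_eq_of_lt h0 h1]
  have e1 : offset u (n + 1) x = proj (!axis n) x + proj (!axis n) (u (n + 2)) := by
    rw [offset, axis_succ, Int.emod_eq_of_lt h2 h3]
  have hd : ∀ d, 0 ≤ proj d x + proj d (u (n + 2)) ∧
      proj d x + proj d (u (n + 2)) < side (n + 2) := by
    intro d
    rcases eq_or_ne d (axis n) with rfl | hne
    · exact hu.inside_succ h0 h1
    · rw [Bool.eq_not_of_ne hne]
      exact ⟨h2, h3⟩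
  -- The point shares the level `n + 2` cell of the origin, so only levels `n` and `n + 1` remain to
  -- be compared.
  have hfar : ∀ m, n + 2 ≤ m → ¬ Low u m x ∧ ¬ High u m x := fun m hm =>
    hu.not_low_not_high_of_le (fun k hk => h k (by omega)) (fun d => (hd d).1)
      (fun d => (hd d).2) hm
  constructor
  · intro ha hb
    refine ⟨n, by rwa [Low, e0], fun m hm => ?_⟩
    rcases Nat.eq_or_lt_of_le (Nat.succ_le_of_lt hm) with rfl | hm
    · rw [High, Nat.succ_eq_add_one, e1, not_le]; exact hb
    · exact (hfar m hm).2
  · intro ha hb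
    refine not_pattern (n := n) (by rwa [High, e0]) fun m hm => ?_
    rcases Nat.eq_or_lt_of_le (Nat.succ_le_of_lt hm) with rfl | hm
    · rw [Low, Nat.succ_eq_add_one, e1]; omega
    · exact (hfar m hm).1

/-- The chain of rows of colour `b` around the origin. -/
def chain (b : Bool) {n₀ : ℕ} (h : ∀ n, n₀ ≤ n → ¬ Low u n 0 ∧ ¬ High u n 0)
    {O : Set (ℤ × ℤ)} (hO : ∀ x, (if b then Pattern u x else ¬ Pattern u x) → x ∈ O) :
    Chain O where
  -- The closed row is the last one across `axis n`; lengthwise it skips the first cell of level `n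
  -- + 1`, which level `n + 1` paints open.
  corner n t := pt (axis n)
    ((if b then 0 else side (n + 1) - side n) - proj (axis n) (u (n + 1)))
    ((if b then 0 else side (n + 1)) - proj (!axis n) (u (n + 2)) + side n * t)
  dir n := !axis n
  len := rowLen
  start := n₀
  corner_succ n t := by
    refine ext_proj (axis n) ?_ ?_
    · simp [-zsmul_eq_mul, unitVec_not]
    · simp [-zsmul_eq_mul, unitVec_not]; ring
  two_le_len := two_le_rowLen
  len_lt := rowLen_lt
  cell_subset n hn t ht x hx := by
    rw [le_rowLen_iff] at ht
    have hi := mem_cell_proj hx (axis n)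
    have hj := mem_cell_proj hx (!axis n)
    rw [proj_pt] at hi
    rw [proj_not_pt] at hj
    have ht0 : 0 ≤ side n * t := mul_nonneg (side_pos n).le (by positivity)
    have hs := side_pos n
    have hs1 := four_mul_side_le n
    have hs2 : 4 * side (n + 1) ≤ side (n + 2) := four_mul_side_le (n + 1)
    refine hO x ?_
    cases b
    · simp only [Bool.false_eq_true, if_false] at hi hj ⊢
      exact (hu.row_colour hn h (by omega) (by omega) (by omega) (by omega)).2 (by omega) (by omega)
    · simp only [if_true] at hi hj ⊢
      exact (hu.row_colour hn h (by omega) (by omega) (by omega) (by omega)).1 (by omega) (by omega)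
  meets n hn := by
    have hs := side_pos n
    have hs1 := four_mul_side_le n
    have hs2 : 4 * side (n + 1) ≤ side (n + 2) := four_mul_side_le (n + 1)
    have hs3 : 4 * side (n + 2) ≤ side (n + 3) := four_mul_side_le (n + 2)
    have hp := hu.lt (n + 2) (axis n)
    have hq := hu.lt (n + 1) (axis n)
    have hp' := hu.nonneg (n + 2) (axis n)
    have hax : axis (n + 2) = axis n := by rw [axis_succ, axis_succ, Bool.not_not]
    -- Level `n + 2` uses the same axis as level `n`. There `hlow` gives `1 ≤ l`, since the closed
    -- row `n + 1` starts one cell of level `n + 2` late, and `hhigh` keeps the meeting point before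
    -- the end of the open row.
    obtain ⟨hlow, hhigh⟩ := h (n + 2) (by omega)
    rw [Low, hu.offset_zero, hax, not_lt] at hlow
    rw [High, hu.offset_zero, hax, not_le] at hhigh
    obtain ⟨k, -, hk⟩ := hu.exists_eq (n + 1) (axis n)
    obtain ⟨l, -, hl⟩ := hu.exists_eq (n + 2) (axis n)
    have hss : side (n + 2) = side (n + 1) * 2 ^ (n + 3) := side_succ (n + 1)
    have hk0 : 0 ≤ side (n + 1) * k := mul_nonneg (side_pos _).le (by positivity)
    have hpow : (1 : ℤ) < 2 ^ (n + 2) := one_lt_pow₀ (by norm_num) (by omega)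
    have hl1 : 1 ≤ l := by
      by_contra hl0
      obtain rfl : l = 0 := by omega
      simp only [Nat.cast_zero, mul_zero, add_zero] at hl
      have hlow' : side (n + 2) ≤ proj (axis n) (u (n + 3)) := hlow
      rw [show n + 3 = n + 2 + 1 from rfl, hl] at hlow'
      omega
    have hT : side (n + 1) * (k + 2 ^ (n + 3) * l) =
        proj (axis n) (u (n + 2 + 1)) - proj (axis n) (u (n + 1)) := by
      rw [hl, hk, hss]; ring
    have hS : side (n + 1 + 2) - side (n + 1 + 1) =
        side (n + 1) * (2 ^ (n + 3) * (2 ^ (n + 4) - 1)) := by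
      rw [side_succ (n + 2), side_succ (n + 1)]; ring
    have hu1 := hu.nonneg (n + 1) (axis n)
    have hlen : ∀ t' : ℕ, side (n + 1) * t' < side (n + 1 + 2) - side (n + 1 + 1) →
        t' ≤ rowLen (n + 1) := by
      intro t' ht'
      rw [le_rowLen_iff]
      rw [hS] at ht' ⊢
      have := lt_of_mul_lt_mul_left ht' (side_pos (n + 1)).le
      rw [← mul_add_one]
      exact mul_le_mul_of_nonneg_left this (side_pos (n + 1)).le
    cases b
    · obtain ⟨l, rfl⟩ : ∃ l', l = l' + 1 := ⟨l - 1, by omega⟩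
      have hT' : side (n + 1) * (k + 2 ^ (n + 3) * l) = proj (axis n) (u (n + 2 + 1))
          - proj (axis n) (u (n + 1)) - side (n + 2) := by
        rw [← hT, hss]; push_cast; ring
      have htop : side n * ((2 ^ (n + 2) * (2 ^ (n + 3) - 2) : ℕ) : ℤ) =
          side (n + 2) - 2 * side (n + 1) := by
        have h2 : 2 ≤ 2 ^ (n + 3) := Nat.le_self_pow (by omega) 2
        rw [hss, side_succ n]
        push_cast [h2]
        ring
      -- Closed rows meet in the last level `n + 1` cell along row `n`, at its first level `n`
      -- subcell lengthwise and its last across.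
      refine ⟨2 ^ (n + 2) * (2 ^ (n + 3) - 2), ?_, k + 2 ^ (n + 3) * l, hlen _ ?_,
        pt (axis n) (2 ^ (n + 2) - 1) 0, ?_, ?_⟩
      · rw [le_rowLen_iff, htop]; omega
      · push_cast
        rw [hT']
        have : 0 < side (n + 2) := side_pos _
        change _ < side (n + 2 + 1) - side (n + 2)
        omega
      · exact pt_mem_positions (by omega) (by omega) le_rfl (by omega)
      · rw [htop, axis_succ, pt_not, Bool.not_not]
        push_cast
        rw [hT']
        refine ext_proj (axis n) ?_ ?_
        · simp [-zsmul_eq_mul]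
          rw [side_succ n]; ring
        · simp [-zsmul_eq_mul]; ring
    -- Open rows meet at the initial cell of row `n`, which shares its corner with a cell of row `n
    -- + 1`.
    · refine ⟨0, Nat.zero_le _, k + 2 ^ (n + 3) * l, hlen _ ?_, 0, ?_, ?_⟩
      · push_cast
        rw [hT]
        change _ < side (n + 2 + 1) - side (n + 2)
        omega
      · exact mem_positions.2 ⟨⟨le_rfl, by simp⟩, le_rfl, by simp⟩
      · rw [axis_succ, pt_not, Bool.not_not]
        push_cast
        rw [hT]
        refine ext_proj (axis n) ?_ ?_
        · simp [show n + 1 + 2 = n + 2 + 1 from rfl]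
          ring
        · simp

end Nested


/-! ### The random hierarchy from the 2-adic odometer. -/

/-- The pairs of `2`-adic integers. -/
abbrev Odometer : Type := ℤ_[2] × ℤ_[2]

noncomputable instance : MeasurableSpace Odometer := borel _

instance : BorelSpace Odometer := ⟨rfl⟩

/-- The normalized Haar measure on the pairs of `2`-adic integers. -/
noncomputable def odometerMeasure : Measure Odometer := Measure.addHaarMeasure ⊤

instance : IsProbabilityMeasure odometerMeasure := ⟨Measure.addHaarMeasure_self⟩

instance : odometerMeasure.IsAddLeftInvariant := by
  unfold odometerMeasure; infer_instance

/-- The image of a point of the square lattice in the pairs of `2`-adic integers. -/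
noncomputable def shift (x : ℤ × ℤ) : Odometer := ((x.1 : ℤ_[2]), (x.2 : ℤ_[2]))

/-- The residue of a coordinate of `ω` modulo `side n`. -/
noncomputable def residue (n : ℕ) (d : Bool) (ω : Odometer) : ZMod (2 ^ expo n) :=
  PadicInt.toZModPow (expo n) (if d then ω.2 else ω.1)

lemma residue_add (n : ℕ) (d : Bool) (ω ω' : Odometer) :
    residue n d (ω + ω') = residue n d ω + residue n d ω' := by
  cases d <;> simp [residue]

lemma residue_shift (n : ℕ) (d : Bool) (x : ℤ × ℤ) :
    residue n d (shift x) = (proj d x : ℤ) := by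
  cases d <;> simp [residue, shift, proj]

lemma isOpen_toZModPow_eq (p : ℕ) [Fact p.Prime] (n : ℕ) (k : ZMod (p ^ n)) :
    IsOpen {x : ℤ_[p] | PadicInt.toZModPow n x = k} := by
  rw [Metric.isOpen_iff]
  intro x hx
  have hp : (0 : ℝ) < p := by exact_mod_cast (Fact.out : p.Prime).pos
  refine ⟨(p : ℝ) ^ (-n : ℤ), zpow_pos hp _, fun y hy => ?_⟩
  rw [mem_ball_iff_norm] at hy
  have h := (PadicInt.norm_le_pow_iff_mem_span_pow _ _).1 hy.le
  rw [← PadicInt.ker_toZModPow, RingHom.mem_ker, map_sub, sub_eq_zero] at h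
  exact h.trans hx

lemma measurableSet_residue (n : ℕ) (d : Bool) (A : Set (ZMod (2 ^ expo n))) :
    MeasurableSet {ω | residue n d ω ∈ A} := by
  have : {ω | residue n d ω ∈ A} = ⋃ k ∈ A, {ω : Odometer | residue n d ω = k} := by
    ext; simp
  rw [this]
  refine (isOpen_biUnion fun k _ => ?_).measurableSet
  cases d
  · exact (isOpen_toZModPow_eq 2 (expo n) k).preimage continuous_fst
  · exact (isOpen_toZModPow_eq 2 (expo n) k).preimage continuous_snd

/-- Lattice shifts permute the residue classes transitively, so invariance gives all of them equal
mass. -/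
lemma measure_residue_eq (n : ℕ) (d : Bool) (k : ZMod (2 ^ expo n)) :
    odometerMeasure {ω | residue n d ω = k} = (2 : ℝ≥0∞)⁻¹ ^ expo n := by
  have htrans : ∀ k, odometerMeasure {ω | residue n d ω = k} =
      odometerMeasure {ω | residue n d ω = 0} := by
    intro k
    rw [← measure_preimage_add odometerMeasure (shift (pt d k.cast 0))]
    congr 1
    ext ω
    simp [residue_add, residue_shift]
  have hsum : ∑ k, odometerMeasure {ω | residue n d ω = k} = 1 := by
    rw [← measure_univ (μ := odometerMeasure), ← measure_biUnion_finset]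
    · congr 1
      ext; simp
    · intro k _ l _ hkl
      exact Set.disjoint_left.2 fun ω hk hl => hkl (hk.symm.trans hl)
    · intro k _
      exact measurableSet_residue n d {k}
  rw [Finset.sum_congr rfl fun k _ => htrans k, Finset.sum_const, Finset.card_univ, ZMod.card,
    nsmul_eq_mul] at hsum
  rw [htrans, ← ENNReal.inv_pow]
  push_cast at hsum
  exact ENNReal.eq_inv_of_mul_eq_one_left ((mul_comm _ _).trans hsum)

lemma measure_residue_mem_le (n : ℕ) (d : Bool) (A : Finset (ZMod (2 ^ expo (n + 1))))
    (hA : A.card ≤ 2 ^ expo n) :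
    odometerMeasure {ω | residue (n + 1) d ω ∈ A} ≤ (2 : ℝ≥0∞)⁻¹ ^ (n + 2) := by
  calc odometerMeasure {ω | residue (n + 1) d ω ∈ A}
      ≤ odometerMeasure (⋃ k ∈ A, {ω | residue (n + 1) d ω = k}) :=
        measure_mono fun ω hω => Set.mem_biUnion (x := residue (n + 1) d ω) hω rfl
    _ ≤ ∑ k ∈ A, odometerMeasure {ω | residue (n + 1) d ω = k} :=
        measure_biUnion_finset_le _ _
    _ = A.card * (2 : ℝ≥0∞)⁻¹ ^ expo (n + 1) := by simp [measure_residue_eq]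
    _ ≤ 2 ^ expo n * (2 : ℝ≥0∞)⁻¹ ^ expo (n + 1) := by
        gcongr
        exact_mod_cast hA
    _ = (2 : ℝ≥0∞)⁻¹ ^ (n + 2) := by
        rw [expo, pow_add _ (expo n), ← mul_assoc, ← mul_pow,
          ENNReal.mul_inv_cancel (by simp) (by simp), one_pow, one_mul]

/-- The cells around `0` determined by `ω` have the lower left corners `-origin ω n`. -/
noncomputable def origin (ω : Odometer) (n : ℕ) : ℤ × ℤ :=
  (((residue n false ω).val : ℤ), ((residue n true ω).val : ℤ))

lemma proj_origin (ω : Odometer) (n : ℕ) (d : Bool) :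
    proj d (origin ω n) = ((residue n d ω).val : ℤ) := by
  cases d <;> rfl

/-- The divisibility is the compatibility of the residues of a 2-adic integer modulo successive
powers of 2. -/
lemma nested_origin (ω : Odometer) : Nested (origin ω) where
  nonneg n d := by rw [proj_origin]; positivity
  lt n d := by
    rw [proj_origin, side]
    exact_mod_cast ZMod.val_lt (residue n d ω)
  dvd n d := by
    rw [proj_origin, proj_origin, side]
    have h := PadicInt.cast_toZModPow (p := 2) (expo n) (expo (n + 1)) (by simp [expo])
      (if d then ω.2 else ω.1)
    have h' : (((residue (n + 1) d ω).val : ℤ) : ZMod (2 ^ expo n)) =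
        (((residue n d ω).val : ℤ) : ZMod (2 ^ expo n)) := by
      rw [Int.cast_natCast, Int.cast_natCast, ZMod.natCast_val, ZMod.natCast_val, residue, h,
        ← residue, ZMod.cast_id]
    rw [eq_comm, ZMod.intCast_eq_intCast_iff_dvd_sub] at h'
    exact_mod_cast h'

/-- The point enters only through `ω + shift x`, so moving the lattice amounts to translating `ω`;
stationarity rests on this. -/
lemma offset_origin (ω : Odometer) (n : ℕ) (x : ℤ × ℤ) :
    offset (origin ω) n x = ((residue (n + 1) (axis n) (ω + shift x)).val : ℤ) := by
  have h : residue (n + 1) (axis n) (ω + shift x) =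
      ((proj (axis n) x + proj (axis n) (origin ω (n + 1)) : ℤ) : ZMod (2 ^ expo (n + 1))) := by
    rw [residue_add, residue_shift, proj_origin]
    push_cast
    rw [ZMod.natCast_zmod_val]
    exact add_comm _ _
  rw [h, ZMod.val_intCast, offset, side]
  push_cast
  rfl

lemma offset_add (ω : Odometer) (n : ℕ) (x y : ℤ × ℤ) :
    offset (origin ω) n (x + y) = offset (origin (ω + shift y)) n x := by
  have : ω + shift (x + y) = ω + shift y + shift x := by
    ext <;> simp [shift, add_comm, add_left_comm]
  rw [offset_origin, offset_origin, this]

lemma pattern_add (ω : Odometer) (x y : ℤ × ℤ) :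
    Pattern (origin ω) (x + y) ↔ Pattern (origin (ω + shift y)) x := by
  simp only [Pattern, Low, High, offset_add]

lemma measurableSet_pattern (x : ℤ × ℤ) : MeasurableSet {ω | Pattern (origin ω) x} := by
  have hm : ∀ (n : ℕ) (T : Set ℤ), MeasurableSet {ω | offset (origin ω) n x ∈ T} := by
    intro n T
    have h := (measurableSet_residue (n + 1) (axis n) {k | (k.val : ℤ) ∈ T}).preimage
      (continuous_add_const (shift x)).measurable
    simp only [offset_origin]
    exact h
  have : {ω | Pattern (origin ω) x} = ⋃ n, ({ω | offset (origin ω) n x ∈ Set.Iio (side n)} ∩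
      ⋂ m, ⋂ (_ : n < m), {ω | offset (origin ω) m x ∈ Set.Ici (side (m + 1) - side m)}ᶜ) := by
    ext ω
    simp [Pattern, Low, High]
  rw [this]
  exact MeasurableSet.iUnion fun n => (hm n _).inter
    (MeasurableSet.iInter fun m => MeasurableSet.iInter fun _ => (hm m _).compl)

open Classical in
/-- The random configuration: the pattern of open sites determined by `ω`. -/
noncomputable def config (ω : Odometer) (x : ℤ × ℤ) : Bool := decide (Pattern (origin ω) x)

lemma measurable_config : Measurable config := by
  refine measurable_pi_lambda _ fun x => measurable_to_bool ?_
  have : (fun ω => config ω x) ⁻¹' {true} = {ω | Pattern (origin ω) x} := by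
    ext; simp [config]
  rw [this]
  exact measurableSet_pattern x

lemma config_add (ω : Odometer) (x y : ℤ × ℤ) :
    config ω (x + y) = config (ω + shift y) x := by
  rw [config, config, decide_eq_decide]
  exact pattern_add ω x y

lemma translationInvariant_config : TranslationInvariant odometerMeasure config := by
  intro n x
  have h : ∀ y, odometerMeasure.map (fun ω i => config ω (x i + y)) =
      odometerMeasure.map (fun ω i => config ω (x i)) := by
    intro y
    have hm : Measurable fun (ω : Odometer) (i : Fin n) => config ω (x i) :=
      measurable_pi_lambda _ fun i => (measurable_pi_apply (x i)).comp measurable_config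
    have hs : Measurable fun ω : Odometer => shift y + ω :=
      (continuous_const_add (shift y)).measurable
    conv_rhs => rw [← map_add_left_eq_self odometerMeasure (shift y), Measure.map_map hm hs]
    congr 1
    funext ω i
    rw [config_add, Function.comp_apply, add_comm]
  intro y z
  rw [h y, h z]

/-- Each extreme row takes up the fraction `side n / side (n + 1) = 2⁻¹ ^ (n + 2)` of its cell. The
growing ratio of sides makes this summable for Borel–Cantelli. -/
lemma ae_eventually_interior : ∀ᵐ ω ∂odometerMeasure, ∃ n₀, ∀ n, n₀ ≤ n →
    ¬ Low (origin ω) n 0 ∧ ¬ High (origin ω) n 0 := by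
  have hz : ∀ ω n, offset (origin ω) n 0 = ((residue (n + 1) (axis n) ω).val : ℤ) := fun ω n => by
    rw [(nested_origin ω).offset_zero, proj_origin]
  have hlow : ∀ n, odometerMeasure {ω | Low (origin ω) n 0} ≤ (2 : ℝ≥0∞)⁻¹ ^ (n + 2) := by
    intro n
    refine (measure_mono fun ω hω => ?_).trans (measure_residue_mem_le n (axis n)
      (Finset.univ.filter fun k => k.val < 2 ^ expo n) ?_)
    · have h : Low (origin ω) n 0 := hω
      rw [Low, hz, side] at h
      simpa using (by exact_mod_cast h : (residue (n + 1) (axis n) ω).val < 2 ^ expo n)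
    · rw [← Finset.card_range (2 ^ expo n)]
      exact Finset.card_le_card_of_injOn ZMod.val (fun k hk => by simpa using hk)
        (ZMod.val_injective _).injOn
  have hhigh : ∀ n, odometerMeasure {ω | High (origin ω) n 0} ≤ (2 : ℝ≥0∞)⁻¹ ^ (n + 2) := by
    intro n
    refine (measure_mono fun ω hω => ?_).trans (measure_residue_mem_le n (axis n)
      (Finset.univ.filter fun k => 2 ^ expo (n + 1) ≤ k.val + 2 ^ expo n) ?_)
    · have h : High (origin ω) n 0 := hω
      rw [High, hz, side, side, sub_le_iff_le_add] at h
      simpa using (by exact_mod_cast h :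
        2 ^ expo (n + 1) ≤ (residue (n + 1) (axis n) ω).val + 2 ^ expo n)
    · refine (Finset.card_le_card_of_injOn ZMod.val (t := Finset.Ico (2 ^ expo (n + 1) - 2 ^ expo n)
        (2 ^ expo (n + 1))) (fun k hk => ?_) (ZMod.val_injective _).injOn).trans ?_
      · have h1 : 2 ^ expo (n + 1) ≤ k.val + 2 ^ expo n := by simpa using hk
        have h2 := ZMod.val_lt k
        simp only [Finset.coe_Ico, Set.mem_Ico]
        omega
      · rw [Nat.card_Ico]
        exact tsub_tsub_le
  have hsum : ∑' n, odometerMeasure {ω | Low (origin ω) n 0 ∨ High (origin ω) n 0} ≠ ∞ := by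
    have hle : ∀ n, odometerMeasure {ω | Low (origin ω) n 0 ∨ High (origin ω) n 0} ≤
        (2 : ℝ≥0∞)⁻¹ ^ n := by
      intro n
      calc _ ≤ (2 : ℝ≥0∞)⁻¹ ^ (n + 2) + (2 : ℝ≥0∞)⁻¹ ^ (n + 2) :=
            (measure_union_le _ _).trans (add_le_add (hlow n) (hhigh n))
        _ = (2 : ℝ≥0∞)⁻¹ ^ (n + 1) := by
            rw [pow_succ _ (n + 1), ← mul_add, ENNReal.inv_two_add_inv_two, mul_one]
        _ ≤ _ := pow_le_pow_of_le_one zero_le (ENNReal.inv_le_one.2 (by norm_num)) (by omega)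
    refine ne_top_of_le_ne_top ?_ (ENNReal.tsum_le_tsum hle)
    rw [ENNReal.tsum_geometric, ENNReal.one_sub_inv_two, inv_inv]
    exact ENNReal.ofNat_ne_top
  filter_upwards [ae_eventually_notMem hsum] with ω hω
  obtain ⟨n₀, h⟩ := Filter.eventually_atTop.1 hω
  exact ⟨n₀, fun n hn => not_or.1 (h n hn)⟩

end SitePerc

theorem mainTheorem2 :
    ∃ (Ω : Type) (_ : MeasurableSpace Ω) (P : Measure Ω) (_ : IsProbabilityMeasure P)
      (X : Ω → ℤ × ℤ → Bool),
      Measurable X ∧ SitePerc.TranslationInvariant P X ∧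
        ∀ᵐ ω ∂P, SitePerc.pcBond (SitePerc.openGraph (X ω)) < 1 ∧
          SitePerc.pcBond (SitePerc.closedGraph (X ω)) < 1 := by
  refine ⟨SitePerc.Odometer, inferInstance, SitePerc.odometerMeasure, inferInstance,
    SitePerc.config, SitePerc.measurable_config, SitePerc.translationInvariant_config, ?_⟩
  filter_upwards [SitePerc.ae_eventually_interior] with ω ⟨n₀, h⟩
  have hu := SitePerc.nested_origin ω
  exact ⟨(hu.chain true h fun x hx => by simpa [SitePerc.config] using hx).pcBond_lt_one,
    (hu.chain false h fun x hx => by simpa [SitePerc.config] using hx).pcBond_lt_one⟩
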